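/- Let $d\ge 2$, $L,\nu,T>0$. Call a function on $\mathbb R^d$ *periodic* if it is $L$-periodic in each coordinate, and write $\mathcal I=[0,L]$ and $\|f\|_\infty=\operatorname{ess\,sup}_{\mathcal I^d}|f|$. Let $u:[0,T]\times\mathbb R^d\to\mathbb R^d$ be such that each $u_t$ is periodic, divergence free and $C^1$ in space, and $u$ and $\nabla u$ are continuous on $[0,T]\times\mathbb R^d$ (this is the case in particular if $u$ is spatially periodic, divergence free and $C^1$ on $[0,T]\times\mathbb R^d$). Let $\theta_0$ be bounded, measurable and periodic with $\int_{\mathcal I^d}\theta_0\,dx=0$. Let $\theta$ be a spatially periodic solution of $$\partial_t\theta+(u\cdot\nabla)\theta-\nu\Delta\theta=0$$ on $(0,T]$ with initial data $\theta_0$; that is, $\theta$ is continuous on $(0,T]\times\mathbb R^d$, is $C^1$ in time and $C^2$ in space on $(0,T)\times\mathbb R^d$ (with $\partial_t\theta$, $\nabla\theta$ and $D^2\theta$ continuous in $(t,x)$), satisfies the equation there, and $\theta_t\to\theta_0$ in $L^1(\mathcal I^d)$ as $t\downarrow0$. If $d\ge3$, there is a constant $c=c(d)>0$, depending only on $d$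 (and not on $u$, $\theta_0$, $\theta$, $L$, $\nu$, $T$), such that for all $t\in(0,T]$ $$\|\theta_t\|_\infty\le\frac{c\,L^d}{(\nu t)^{d/2}}\,\|\theta_0\|_\infty .$$ If $d=2$, then for every $\varepsilon>0$ there is a constant $c_\varepsilon>0$, depending only on $\varepsilon$, such that for all $t\in(0,T]$ $$\|\theta_t\|_\infty\le\frac{c_\varepsilon\,L^{2+\varepsilon}}{(\nu t)^{(2+\varepsilon)/2}}\,\|\theta_0\|_\infty .$$ -/

import Mathlib

open MeasureTheory Set Filter Topology
open scoped ENNReal Laplacian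

namespace HeatDecay

/-- `d`-dimensional Euclidean space. -/
abbrev E (d : ℕ) : Type := EuclideanSpace ℝ (Fin d)

/-- The period cell `[0, L]^d`. -/
def cell (d : ℕ) (L : ℝ) : Set (E d) := {x | ∀ i, x i ∈ Icc 0 L}

/-- Lebesgue measure on the period cell. -/
noncomputable def cellMeasure (d : ℕ) (L : ℝ) : Measure (E d) :=
  volume.restrict (cell d L)

/-- The `L^∞` norm over the period cell, with value `∞` for an unbounded function. -/
noncomputable def supNorm {d : ℕ} (L : ℝ) (f : E d → ℝ) : ℝ≥0∞ :=
  eLpNorm f ∞ (cellMeasure d L)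

/-- Periodicity with period `L` in every coordinate direction. -/
def IsPeriodic {d : ℕ} {F : Type*} (L : ℝ) (f : E d → F) : Prop :=
  ∀ (x : E d) (i : Fin d), f (x + EuclideanSpace.single i L) = f x

/-- The divergence `∑ i, ∂_i v_i` of a vector field at `x`. -/
noncomputable def divergence {d : ℕ} (v : E d → E d) (x : E d) : ℝ :=
  ∑ i : Fin d, (fderiv ℝ v x (EuclideanSpace.single i 1)) i

/-- A spatially periodic, divergence-free drift on `[0, T] × ℝ^d` which is `C^1` in space, and
which together with its spatial derivative is continuous in time and space. No differentiability
in time is asked for; every drift that is jointly `C^1` on `[0, T] × ℝ^d` is included. -/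
structure IsIncompressibleDrift {d : ℕ} (L T : ℝ) (u : ℝ → E d → E d) : Prop where
  periodic : ∀ t ∈ Icc 0 T, IsPeriodic L (u t)
  contDiff : ∀ t ∈ Icc 0 T, ContDiff ℝ 1 (u t)
  continuousOn : ContinuousOn (fun p : ℝ × E d => u p.1 p.2) (Icc 0 T ×ˢ univ)
  continuousOn_fderiv :
    ContinuousOn (fun p : ℝ × E d => fderiv ℝ (u p.1) p.2) (Icc 0 T ×ˢ univ)
  divergence_eq_zero : ∀ t ∈ Icc 0 T, ∀ x, divergence (u t) x = 0

/-- `θ` is a spatially periodic solution on `(0, T]` of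
`∂_t θ + (u · ∇) θ - ν Δ θ = 0` with initial data `θ₀`: it is continuous on `(0, T] × ℝ^d`,
it is `C^1` in time and `C^2` in space on `(0, T) × ℝ^d`, where it satisfies the equation
pointwise, and `θ t → θ₀` in `L^1` of the period cell as `t ↓ 0`. The continuity of `∂_t θ` is a
consequence of the equation. The initial condition is the one suited to bounded measurable data;
for `θ` continuous up to `t = 0` it is implied by `θ 0 = θ₀`. -/
structure IsSolution {d : ℕ} (L ν T : ℝ) (u : ℝ → E d → E d) (θ₀ : E d → ℝ)
    (θ : ℝ → E d → ℝ) : Prop where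
  periodic : ∀ t ∈ Ioc 0 T, IsPeriodic L (θ t)
  continuousOn : ContinuousOn (fun p : ℝ × E d => θ p.1 p.2) (Ioc 0 T ×ˢ univ)
  contDiff : ∀ t ∈ Ioo 0 T, ContDiff ℝ 2 (θ t)
  continuousOn_fderiv :
    ContinuousOn (fun p : ℝ × E d => fderiv ℝ (θ p.1) p.2) (Ioo 0 T ×ˢ univ)
  continuousOn_iteratedFDeriv :
    ContinuousOn (fun p : ℝ × E d => iteratedFDeriv ℝ 2 (θ p.1) p.2) (Ioo 0 T ×ˢ univ)
  equation : ∀ t ∈ Ioo 0 T, ∀ x : E d, ∃ θt : ℝ, HasDerivAt (fun s => θ s x) θt t ∧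
    θt + fderiv ℝ (θ t) x (u t x) - ν * Δ (θ t) x = 0
  initial : Tendsto (fun t => eLpNorm (fun x => θ t x - θ₀ x) 1 (cellMeasure d L))
    (𝓝[>] 0) (𝓝 0)

/-- Admissible initial data: bounded (measurable), periodic, with mean zero over a period. -/
structure IsInitialData {d : ℕ} (L : ℝ) (θ₀ : E d → ℝ) : Prop where
  memLp : MemLp θ₀ ∞ (cellMeasure d L)
  periodic : IsPeriodic L θ₀
  mean_zero : ∫ x, θ₀ x ∂(cellMeasure d L) = 0

end HeatDecay

namespace HeatDecay

variable {d : ℕ} {L ν T : ℝ}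

/-! The algebraic bounds follow from an exponential one: almost everywhere on the cell, |θ_t| ≤
2^(d+1) q ‖θ₀‖_∞ with q = exp(-νt/(dL²)). Since exp(-s/d) ≤ (dN)^N / s^N for every N > 0, applied
with s = νt/L², each order of decay is available; N = d/2 and N = (2+ε)/2 give the two claims.

No constant sees the drift: when a function of θ is used as a test function, incompressibility and
periodicity turn the transport term into the integral of a divergence, which vanishes
(`integral_mul_driftDiffusion`). Hence integrals of convex functions of θ decrease. Applied to a
smoothed positive part this gives the maximum principle |θ_t| ≤ m = ‖θ₀‖_∞; applied to linear
functions it preserves mean zero, so the Poincaré inequality yields exponential decay in L².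

Decay passes from L² to L^∞ by a Moser iteration along the times τ_k = t(1 - 2^(-k)), on the moments
M_k = ∫ θ(τ_k)^(2^k). A Nash inequality at scale h = L/2^k (`IsPeriodic.nash`) makes the next moment
relax at rate 4ν/(dh²) towards a multiple of M_k². This rate grows like 4^k while the time step
shrinks like 2^(-k), so the unrelaxed part carries exactly q^(2^(k+1)). The maximum principle bounds
the moment multiplying it by m^(2^k) M_k, and `moser_recursion` closes the estimate with M_k ≤ L^d
(2^(d+1) q m)^(2^k). Letting k → ∞ recovers the supremum. -/

/-! ### The period cell and translation of periodic integrals -/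

theorem cell_eq_preimage (d : ℕ) (L : ℝ) :
    cell d L = WithLp.ofLp ⁻¹' (Set.univ.pi fun _ : Fin d => Icc (0 : ℝ) L) := by
  ext x; simp only [cell, mem_preimage, mem_univ_pi, mem_ofPred_eq]

theorem isCompact_cell (d : ℕ) (L : ℝ) : IsCompact (cell d L) := by
  rw [cell_eq_preimage]
  exact (PiLp.homeomorph 2 (fun _ : Fin d => ℝ)).isCompact_preimage.2
    (isCompact_univ_pi fun _ => isCompact_Icc)

theorem measurableSet_cell (d : ℕ) (L : ℝ) : MeasurableSet (cell d L) :=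
  (isCompact_cell d L).measurableSet

theorem volume_cell (d : ℕ) (hL : 0 ≤ L) : volume (cell d L) = ENNReal.ofReal (L ^ d) := by
  rw [cell_eq_preimage, (PiLp.volume_preserving_ofLp (Fin d)).measure_preimage
    (MeasurableSet.univ_pi fun _ => measurableSet_Icc).nullMeasurableSet, volume_pi_pi]
  simp [ENNReal.ofReal_pow hL]

theorem volume_real_cell (d : ℕ) (hL : 0 ≤ L) : volume.real (cell d L) = L ^ d := by
  rw [measureReal_def, volume_cell d hL, ENNReal.toReal_ofReal (by positivity)]

instance isFiniteMeasure_cellMeasure (d : ℕ) (L : ℝ) : IsFiniteMeasure (cellMeasure d L) :=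
  ⟨by simpa [cellMeasure] using (isCompact_cell d L).measure_lt_top⟩

theorem cellMeasure_real_univ (d : ℕ) (hL : 0 ≤ L) : (cellMeasure d L).real univ = L ^ d := by
  simp [cellMeasure, volume_real_cell d hL]

theorem integrable_cellMeasure {f : E d → ℝ} (hf : Continuous f) :
    Integrable f (cellMeasure d L) :=
  hf.continuousOn.integrableOn_compact (isCompact_cell d L)

/-- The basis of period vectors. -/
noncomputable def periodBasis (d : ℕ) (hL : 0 < L) : Module.Basis (Fin d) ℝ (E d) :=
  (EuclideanSpace.basisFun (Fin d) ℝ).toBasis.isUnitSMul fun _ => hL.ne'.isUnit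

theorem fundamentalDomain_periodBasis_ae_eq (d : ℕ) (hL : 0 < L) :
    ZSpan.fundamentalDomain (periodBasis d hL) =ᵐ[volume] cell d L := by
  have h : ZSpan.fundamentalDomain (periodBasis d hL) =
      WithLp.ofLp ⁻¹' (Set.univ.pi fun _ : Fin d => Ico (0 : ℝ) L) := by
    ext x
    simp only [ZSpan.mem_fundamentalDomain, periodBasis, Module.Basis.repr_isUnitSMul,
      mem_preimage, mem_univ_pi]
    refine forall_congr' fun i => ?_
    have : (hL.ne'.isUnit.unit⁻¹ : ℝˣ) • ((EuclideanSpace.basisFun (Fin d) ℝ).toBasis.repr x i)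
        = x i / L := by
      simp [Units.smul_def, div_eq_inv_mul]
    rw [this, mem_Ico, mem_Ico, div_lt_one hL, le_div_iff₀ hL, zero_mul]
  rw [h, cell_eq_preimage]
  exact (PiLp.volume_preserving_ofLp (Fin d)).quasiMeasurePreserving.preimage_ae_eq
    (Set.pi_univ_Icc (fun _ : Fin d => (0 : ℝ)) (fun _ => L) ▸ Measure.univ_pi_Ico_ae_eq_Icc)

theorem IsPeriodic.add_of_mem_span {f : E d → ℝ} (hf : IsPeriodic L f) (hL : 0 < L) {g : E d}
    (hg : g ∈ Submodule.span ℤ (Set.range (periodBasis d hL))) (x : E d) : f (x + g) = f x := by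
  have hb (i : Fin d) : periodBasis d hL i = EuclideanSpace.single i L := by
    ext j
    simp [periodBasis, Module.Basis.isUnitSMul_apply]
  have key : ∀ g ∈ Submodule.span ℤ (Set.range (periodBasis d hL)), ∀ x, f (x + g) = f x := by
    intro g hg
    rw [← Submodule.mem_toAddSubgroup, Submodule.span_int_eq_addSubgroupClosure] at hg
    induction hg using AddSubgroup.closure_induction with
    | mem y hy =>
      obtain ⟨i, rfl⟩ := hy
      intro x
      rw [hb]
      exact hf x i
    | zero => simp
    | add y z _ _ h1 h2 => intro x; rw [← add_assoc, h2, h1]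
    | neg y _ h => intro x; have := h (x + -y); rwa [neg_add_cancel_right, eq_comm] at this
  exact key g hg x

/-- The cell and its translate are, up to null sets, both fundamental domains of the period lattice,
and a lattice-invariant function has the same integral over any two of them. -/
theorem IsPeriodic.integral_translate {f : E d → ℝ} (hf : IsPeriodic L f) (hL : 0 < L)
    (z : E d) : ∫ x, f (x + z) ∂cellMeasure d L = ∫ x, f x ∂cellMeasure d L := by
  set D := ZSpan.fundamentalDomain (periodBasis d hL)
  have hD := ZSpan.isAddFundamentalDomain (periodBasis d hL) volume
  have hc (g : E d → ℝ) : ∫ x, g x ∂cellMeasure d L = ∫ x in D, g x :=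
    (setIntegral_congr_set (fundamentalDomain_periodBasis_ae_eq d hL)).symm
  rw [hc, hc]
  have h2 := hD.vadd_of_comm z
  have : VAddInvariantMeasure (Submodule.span ℤ (Set.range (periodBasis d hL))) (E d) volume :=
    ⟨fun c s _ => measure_preimage_add volume (c : E d) s⟩
  have h3 := hD.setIntegral_eq h2 (f := f) fun g x => by
    rw [Submodule.vadd_def, vadd_eq_add, add_comm]
    exact hf.add_of_mem_span hL g.2 x
  rw [h3]
  have := (measurePreserving_add_left volume z).setIntegral_image_emb
    (measurableEmbedding_addLeft z) f D
  simp only [add_comm z] at this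
  rw [← this]
  congr 2
  rw [← Set.image_vadd]
  simp [D, add_comm]

theorem IsPeriodic.periodic_fderiv {F : Type*} [NormedAddCommGroup F] [NormedSpace ℝ F] {f : E d → F}
    (hf : IsPeriodic L f) : IsPeriodic L (fderiv ℝ f) := by
  intro x i
  rw [← fderiv_comp_add_right]
  congr 1
  ext y
  exact hf y i

theorem sub_eq_integral_fderiv {f : E d → ℝ} (hf : ContDiff ℝ 1 f) (x v : E d) :
    f (x + v) - f x = ∫ r in (0 : ℝ)..1, fderiv ℝ f (x + r • v) v := by
  have h (r : ℝ) : HasDerivAt (fun r : ℝ => f (x + r • v)) (fderiv ℝ f (x + r • v) v) r := by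
    have h1 : HasDerivAt (fun r : ℝ => x + r • v) v r := by
      simpa using ((hasDerivAt_id r).smul_const v).const_add x
    exact ((hf.differentiable (by simp)) _).hasFDerivAt.comp_hasDerivAt r h1
  have hc : Continuous fun r : ℝ => fderiv ℝ f (x + r • v) v :=
    ((hf.continuous_fderiv (by simp)).comp (by fun_prop)).clm_apply continuous_const
  rw [intervalIntegral.integral_eq_sub_of_hasDerivAt (fun r _ => h r)
    (hc.intervalIntegrable _ _)]
  simp

theorem integrable_prod_of_continuous {X Y : Type*} [TopologicalSpace X] [TopologicalSpace Y]
    [MeasurableSpace X] [MeasurableSpace Y] [OpensMeasurableSpace (X × Y)]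
    [T2Space (X × Y)] [BorelSpace X] [BorelSpace Y]
    {μ : Measure X} {ν : Measure Y} [SFinite μ] [SFinite ν]
    [IsFiniteMeasureOnCompacts μ] [IsFiniteMeasureOnCompacts ν]
    {K : Set X} {S : Set Y} (hK : IsCompact K) (hS : IsCompact S) {f : X × Y → ℝ}
    (hf : Continuous f) : Integrable f ((μ.restrict K).prod (ν.restrict S)) := by
  rw [Measure.prod_restrict]
  refine hf.continuousOn.integrableOn_of_subset_isCompact (hK.prod hS) (hK.prod hS).measurableSet
    subset_rfl ?_
  rw [Measure.prod_prod]
  exact ENNReal.mul_ne_top hK.measure_lt_top.ne hS.measure_lt_top.ne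

/-- The integral of a directional derivative of a periodic function over a period vanishes. -/
theorem IsPeriodic.integral_fderiv_apply {f : E d → ℝ} (hp : IsPeriodic L f) (hL : 0 < L)
    (hf : ContDiff ℝ 1 f) (v : E d) : ∫ x, fderiv ℝ f x v ∂cellMeasure d L = 0 := by
  have hc := hf.continuous_fderiv (by simp)
  -- Write f(x+v) - f(x) as the integral of Df(x+rv)v over r in [0,1]. The left side has integral
  -- zero, and on the right every r contributes the same integral, so no boundary terms arise.
  have h0 : ∫ x, (f (x + v) - f x) ∂cellMeasure d L = 0 := by
    have hc' : Continuous fun x => f (x + v) := hf.continuous.comp (by fun_prop)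
    rw [integral_sub (integrable_cellMeasure hc')
      (integrable_cellMeasure hf.continuous), hp.integral_translate hL, sub_self]
  simp_rw [sub_eq_integral_fderiv hf, intervalIntegral.integral_of_le zero_le_one,
    ← integral_Icc_eq_integral_Ioc] at h0
  rw [cellMeasure, integral_integral_swap (integrable_prod_of_continuous (isCompact_cell d L)
    isCompact_Icc ((hc.comp (by fun_prop)).clm_apply continuous_const))] at h0
  have h1 : IsPeriodic L fun x => fderiv ℝ f x v := fun x i =>
    congr($(hp.periodic_fderiv x i) v)
  have h2 (r : ℝ) := h1.integral_translate hL (r • v)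
  rw [cellMeasure] at h2
  simp_rw [h2] at h0
  simpa [cellMeasure] using h0

/-! ### Nash and Poincaré inequalities by averaging translations -/

/-- The squared length of the gradient. -/
noncomputable def gradSq (f : E d → ℝ) (x : E d) : ℝ :=
  ∑ i : Fin d, (fderiv ℝ f x (EuclideanSpace.single i 1)) ^ 2

theorem gradSq_nonneg (f : E d → ℝ) (x : E d) : 0 ≤ gradSq f x :=
  Finset.sum_nonneg fun _ _ => sq_nonneg _

theorem continuous_gradSq {f : E d → ℝ} (hf : ContDiff ℝ 1 f) : Continuous (gradSq f) :=
  continuous_finsetSum _ fun _ _ =>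
    ((hf.continuous_fderiv (by simp)).clm_apply continuous_const).pow 2

theorem IsPeriodic.gradSq {f : E d → ℝ} (hf : IsPeriodic L f) : IsPeriodic L (gradSq f) :=
  fun x i => by simp only [HeatDecay.gradSq, hf.periodic_fderiv x i]

theorem clm_apply_eq_sum (A : E d →L[ℝ] ℝ) (v : E d) :
    A v = ∑ i : Fin d, v i * A (EuclideanSpace.single i 1) := by
  conv_lhs => rw [← (EuclideanSpace.basisFun (Fin d) ℝ).sum_repr v]
  simp

theorem sq_fderiv_apply_le (f : E d → ℝ) (x v : E d) :
    (fderiv ℝ f x v) ^ 2 ≤ ‖v‖ ^ 2 * gradSq f x := by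
  rw [clm_apply_eq_sum, EuclideanSpace.real_norm_sq_eq]
  exact Finset.sum_mul_sq_le_sq_mul_sq _ _ _

theorem sq_integral_le_integral_sq {X : Type*} [MeasurableSpace X] {μ : Measure X}
    [IsProbabilityMeasure μ] {g : X → ℝ} (hg : Integrable g μ)
    (hg2 : Integrable (fun x => g x ^ 2) μ) : (∫ x, g x ∂μ) ^ 2 ≤ ∫ x, g x ^ 2 ∂μ := by
  set c := ∫ x, g x ∂μ
  have h : 0 ≤ ∫ x, (g x - c) ^ 2 ∂μ := integral_nonneg fun _ => sq_nonneg _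
  have h1 : ∫ x, (g x - c) ^ 2 ∂μ = ∫ x, (g x ^ 2 - 2 * c * g x + c ^ 2) ∂μ := by
    congr 1; ext x; ring
  have i2 : Integrable (fun x => 2 * c * g x) μ := hg.const_mul _
  have i3 : Integrable (fun x => g x ^ 2 - 2 * c * g x) μ := hg2.sub i2
  rw [h1, integral_add i3 (integrable_const _), integral_sub hg2 i2, integral_const_mul] at h
  simp only [integral_const, probReal_univ, one_smul] at h
  nlinarith

/-- Jensen along the segment from x to x+z bounds the squared increment by the average of |z|²|∇w|²
over the segment; integrating over a period removes the shift. -/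
theorem IsPeriodic.integral_sq_translate_sub_le {w : E d → ℝ} (hp : IsPeriodic L w) (hL : 0 < L)
    (hw : ContDiff ℝ 1 w) (z : E d) :
    ∫ x, (w (x + z) - w x) ^ 2 ∂cellMeasure d L ≤
      ‖z‖ ^ 2 * ∫ x, HeatDecay.gradSq w x ∂cellMeasure d L := by
  have hg := continuous_gradSq hw
  have hc := hw.continuous_fderiv (by simp)
  have hwc := hw.continuous
  have hgz : Continuous fun p : E d × ℝ => ‖z‖ ^ 2 * HeatDecay.gradSq w (p.1 + p.2 • z) :=
    continuous_const.mul (hg.comp (by fun_prop))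
  have hI := integrable_prod_of_continuous (μ := (volume : Measure (E d)))
    (ν := (volume : Measure ℝ)) (isCompact_cell d L) (isCompact_Icc (a := (0 : ℝ)) (b := 1)) hgz
  have : IsProbabilityMeasure ((volume : Measure ℝ).restrict (Icc 0 1)) := ⟨by simp⟩
  have hpt (x : E d) : (w (x + z) - w x) ^ 2 ≤
      ∫ r in Icc (0 : ℝ) 1, ‖z‖ ^ 2 * HeatDecay.gradSq w (x + r • z) := by
    have hcr : Continuous fun r : ℝ => fderiv ℝ w (x + r • z) z :=
      (hc.comp (by fun_prop)).clm_apply continuous_const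
    have hgr : Continuous fun r : ℝ => ‖z‖ ^ 2 * HeatDecay.gradSq w (x + r • z) :=
      continuous_const.mul (hg.comp (by fun_prop))
    rw [sub_eq_integral_fderiv hw, intervalIntegral.integral_of_le zero_le_one,
      ← integral_Icc_eq_integral_Ioc]
    refine (sq_integral_le_integral_sq hcr.integrableOn_Icc (hcr.pow 2).integrableOn_Icc).trans ?_
    exact integral_mono (hcr.pow 2).integrableOn_Icc hgr.integrableOn_Icc
      fun r => sq_fderiv_apply_le w _ z
  have hcw : Continuous fun x => (w (x + z) - w x) ^ 2 := by fun_prop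
  refine (integral_mono (integrable_cellMeasure hcw) hI.integral_prod_left hpt).trans_eq ?_
  simp only
  rw [cellMeasure, integral_integral_swap hI]
  have h2 (r : ℝ) := hp.gradSq.integral_translate hL (r • z)
  rw [cellMeasure] at h2
  simp_rw [integral_const_mul, h2]
  simp

theorem norm_sq_le_of_mem_cell {h : ℝ} {z : E d} (hz : z ∈ cell d h) :
    ‖z‖ ^ 2 ≤ d * h ^ 2 := by
  rw [EuclideanSpace.real_norm_sq_eq]
  refine (Finset.sum_le_sum fun i _ => pow_le_pow_left₀ (hz i).1 (hz i).2 2).trans_eq ?_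
  simp

/-- The identity behind the Nash and Poincaré inequalities: translations by the vectors of a cube
are averaged. -/
theorem IsPeriodic.mul_integral_sq_le {w : E d → ℝ} (hp : IsPeriodic L w) (hL : 0 < L)
    (hw : ContDiff ℝ 1 w) {h : ℝ} (hh : 0 < h) :
    h ^ d * ∫ x, w x ^ 2 ∂cellMeasure d L ≤
      h ^ d * (d * h ^ 2 / 2 * ∫ x, HeatDecay.gradSq w x ∂cellMeasure d L) +
      ∫ x, w x * ∫ z, w (x + z) ∂cellMeasure d h ∂cellMeasure d L := by
  have hwc := hw.continuous
  set G := ∫ x, HeatDecay.gradSq w x ∂cellMeasure d L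
  have hG : 0 ≤ G := integral_nonneg fun x => gradSq_nonneg w x
  set S := ∫ x, w x ^ 2 ∂cellMeasure d L
  have hc : Continuous fun p : E d × E d => w p.1 * w (p.1 + p.2) := by fun_prop
  have hI : Integrable (fun p : E d × E d => w p.1 * w (p.1 + p.2))
      ((cellMeasure d L).prod (cellMeasure d h)) :=
    integrable_prod_of_continuous (isCompact_cell d L) (isCompact_cell d h) hc
  simp_rw [← integral_const_mul]
  rw [integral_integral_swap hI]
  -- Expanding the square, ∫ w(x)w(x+z) = ∫ w² - ½ ∫ (w(x+z) - w(x))², and |z|² ≤ d h² on the cube.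
  -- This is then integrated over z in the cube, of volume h^d.
  have hz : ∀ z ∈ cell d h, S - d * h ^ 2 / 2 * G ≤ ∫ x, w x * w (x + z) ∂cellMeasure d L := by
    intro z hz
    have h1 := hp.integral_sq_translate_sub_le hL hw z
    have h2 : ∫ x, (w (x + z) - w x) ^ 2 ∂cellMeasure d L =
        ∫ x, (w (x + z) ^ 2 + w x ^ 2 - 2 * (w x * w (x + z))) ∂cellMeasure d L := by
      congr 1; ext x; ring
    have h3 : IsPeriodic L fun x => w x ^ 2 := fun x i => by simp only [hp x i]
    have i1 : Integrable (fun x => w (x + z) ^ 2) (cellMeasure d L) :=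
      integrable_cellMeasure (by fun_prop)
    have i2 : Integrable (fun x => w x ^ 2) (cellMeasure d L) :=
      integrable_cellMeasure (by fun_prop)
    have i3 : Integrable (fun x => 2 * (w x * w (x + z))) (cellMeasure d L) :=
      integrable_cellMeasure (by fun_prop)
    have i4 : Integrable (fun x => w (x + z) ^ 2 + w x ^ 2) (cellMeasure d L) := i1.add i2
    rw [h2, integral_sub i4 i3, integral_add i1 i2,
      h3.integral_translate hL, integral_const_mul] at h1
    have h4 := mul_le_mul_of_nonneg_right (norm_sq_le_of_mem_cell hz) hG
    linarith
  have hmono : ∫ _z, (S - d * h ^ 2 / 2 * G) ∂cellMeasure d h ≤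
      ∫ z, ∫ x, w x * w (x + z) ∂cellMeasure d L ∂cellMeasure d h :=
    setIntegral_mono_on (integrable_const (μ := cellMeasure d h) _) hI.integral_prod_right (measurableSet_cell d h) hz
  rw [integral_const, cellMeasure_real_univ d hh.le, smul_eq_mul] at hmono
  linarith

/-- The correlation term is controlled by the L¹ norm alone: since h ≤ L, the integral of w over a
translated small cube is at most ∫ |w| over a whole period. The scale h stays free, to be refined at
each iteration step. -/
theorem IsPeriodic.nash {w : E d → ℝ} (hp : IsPeriodic L w) (hw : ContDiff ℝ 1 w)
    {h : ℝ} (hh : 0 < h) (hhL : h ≤ L) :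
    ∫ x, w x ^ 2 ∂cellMeasure d L ≤
      d * h ^ 2 / 2 * ∫ x, HeatDecay.gradSq w x ∂cellMeasure d L +
      (∫ x, |w x| ∂cellMeasure d L) ^ 2 / h ^ d := by
  have hL := hh.trans_le hhL
  have hwc := hw.continuous
  have h1 := hp.mul_integral_sq_le hL hw hh
  have hpa : IsPeriodic L fun x => |w x| := fun x i => by simp only [hp x i]
  have hi : Integrable (fun x => |w x|) (cellMeasure d L) := integrable_cellMeasure (by fun_prop)
  have hsub : cell d h ⊆ cell d L := fun x hx i => ⟨(hx i).1, (hx i).2.trans hhL⟩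
  have hin (x : E d) : |∫ z, w (x + z) ∂cellMeasure d h| ≤ ∫ x, |w x| ∂cellMeasure d L := by
    refine (abs_integral_le_integral_abs).trans ?_
    have := hpa.integral_translate hL x
    simp only [add_comm _ x] at this
    rw [← this]
    have hix : Integrable (fun z => |w (x + z)|) (cellMeasure d L) :=
      integrable_cellMeasure (by fun_prop)
    exact setIntegral_mono_set hix (Eventually.of_forall fun _ => abs_nonneg _)
      hsub.eventuallyLE
  have h2 : ∫ x, w x * ∫ z, w (x + z) ∂cellMeasure d h ∂cellMeasure d L ≤
      (∫ x, |w x| ∂cellMeasure d L) ^ 2 := by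
    rw [sq, ← integral_mul_const]
    refine (le_abs_self _).trans (abs_integral_le_integral_abs.trans ?_)
    refine integral_mono_of_nonneg (Eventually.of_forall fun _ => abs_nonneg _)
      (hi.mul_const _) (Eventually.of_forall fun x => ?_)
    simp only [abs_mul]
    exact mul_le_mul_of_nonneg_left (hin x) (abs_nonneg _)
  have hd : 0 < h ^ d := by positivity
  refine le_of_mul_le_mul_left ?_ hd
  rw [mul_add, mul_div_cancel₀ _ hd.ne']
  exact h1.trans (by gcongr)

/-- At h = L the inner average is taken over a full period, so it is the mean of w and the
correlation term disappears. -/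
theorem IsPeriodic.poincare {w : E d → ℝ} (hp : IsPeriodic L w) (hL : 0 < L)
    (hw : ContDiff ℝ 1 w) (h0 : ∫ x, w x ∂cellMeasure d L = 0) :
    ∫ x, w x ^ 2 ∂cellMeasure d L ≤
      d * L ^ 2 / 2 * ∫ x, HeatDecay.gradSq w x ∂cellMeasure d L := by
  have h1 := hp.mul_integral_sq_le hL hw hL
  have h2 (x : E d) : ∫ z, w (x + z) ∂cellMeasure d L = 0 := by
    have := hp.integral_translate hL x
    simp only [add_comm _ x] at this
    rw [this, h0]
  simp only [h2, mul_zero, integral_zero, add_zero] at h1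
  exact le_of_mul_le_mul_left h1 (by positivity)

/-! ### Energy identity and monotone convex functionals -/

theorem laplacian_eq_sum (v : E d → ℝ) (x : E d) :
    Δ v x = ∑ i : Fin d, fderiv ℝ (fderiv ℝ v) x (EuclideanSpace.single i 1)
      (EuclideanSpace.single i 1) := by
  rw [InnerProductSpace.laplacian_eq_iteratedFDeriv_orthonormalBasis v
    (EuclideanSpace.basisFun (Fin d) ℝ)]
  simp [iteratedFDeriv_two_apply]

/-- Testing the drift-diffusion operator with `Φ' ∘ v`, where the drift is incompressible. -/
theorem integral_mul_driftDiffusion (hL : 0 < L) {v : E d → ℝ} {V : E d → E d} {Φ Φ' Φ'' : ℝ → ℝ}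
    (hv : ContDiff ℝ 2 v) (hvp : IsPeriodic L v) (hV : ContDiff ℝ 1 V) (hVp : IsPeriodic L V)
    (hdiv : ∀ x, divergence V x = 0) (h1 : ∀ y, HasDerivAt Φ (Φ' y) y)
    (h2 : ∀ y, HasDerivAt Φ' (Φ'' y) y) (h3 : Continuous Φ'') :
    ∫ x, Φ' (v x) * (ν * Δ v x - fderiv ℝ v x (V x)) ∂cellMeasure d L =
      -ν * ∫ x, Φ'' (v x) * gradSq v x ∂cellMeasure d L := by
  have hv1 : ContDiff ℝ 1 v := hv.of_le (by norm_num)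
  have hΦ' : ContDiff ℝ 1 Φ' := by
    rw [contDiff_one_iff_deriv]
    refine ⟨fun y => (h2 y).differentiableAt, ?_⟩
    rwa [show deriv Φ' = Φ'' from funext fun y => (h2 y).deriv]
  have hΦ : ContDiff ℝ 1 Φ := by
    rw [contDiff_one_iff_deriv]
    refine ⟨fun y => (h1 y).differentiableAt, ?_⟩
    rw [show deriv Φ = Φ' from funext fun y => (h1 y).deriv]
    exact hΦ'.continuous
  have hdv : ContDiff ℝ 1 (fderiv ℝ v) := hv.fderiv_right (by norm_num)
  let e (i : Fin d) : E d := EuclideanSpace.single i 1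
  -- Components of the periodic field ν Φ'(v)∇v - Φ(v)V, whose divergence integrates to zero. Its
  -- divergence is νΦ''(v)|∇v|² plus the tested operator, the term Φ(v) div V being zero.
  let F (i : Fin d) (y : E d) : ℝ := ν * (Φ' (v y) * fderiv ℝ v y (e i)) - Φ (v y) * V y i
  have hVi (i : Fin d) : ContDiff ℝ 1 fun y => V y i := (contDiff_euclidean.1 hV) i
  have hF (i : Fin d) : ContDiff ℝ 1 (F i) :=
    (contDiff_const.mul ((hΦ'.comp hv1).mul (hdv.clm_apply contDiff_const))).sub
      ((hΦ.comp hv1).mul (hVi i))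
  have hFp (i : Fin d) : IsPeriodic L (F i) := fun x j => by
    simp only [F, hvp x j, hVp x j, hvp.periodic_fderiv x j]
  have hFd (i : Fin d) (x : E d) : fderiv ℝ (F i) x (e i) =
      ν * (Φ'' (v x) * (fderiv ℝ v x (e i)) ^ 2 +
        Φ' (v x) * fderiv ℝ (fderiv ℝ v) x (e i) (e i)) -
      (Φ' (v x) * (V x i * fderiv ℝ v x (e i)) + Φ (v x) * (fderiv ℝ V x (e i)) i) := by
    have d1 := (hv1.differentiable (by simp) x).hasFDerivAt
    have d2 := (hdv.differentiable (by simp) x).hasFDerivAt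
    have d3 := (hV.differentiable (by simp) x).hasFDerivAt
    have a1 := (h2 (v x)).comp_hasFDerivAt x d1
    have a2 := (h1 (v x)).comp_hasFDerivAt x d1
    have a3 := d2.clm_apply (hasFDerivAt_const (e i) x)
    have a4 := (EuclideanSpace.proj (𝕜 := ℝ) i).hasFDerivAt.comp x d3
    have a5 := ((a1.mul a3).const_mul ν).sub (a2.mul a4)
    rw [HasFDerivAt.fderiv (f := F i) a5]
    simp
    ring
  have hsum (x : E d) : ∑ i, fderiv ℝ (F i) x (e i) =
      ν * (Φ'' (v x) * gradSq v x) + Φ' (v x) * (ν * Δ v x - fderiv ℝ v x (V x)) := by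
    have hd := hdiv x
    rw [divergence] at hd
    rw [laplacian_eq_sum, clm_apply_eq_sum _ (V x), gradSq]
    simp only [hFd, Finset.sum_sub_distrib, Finset.sum_add_distrib, ← Finset.mul_sum, e, hd]
    ring
  have hcF (i : Fin d) : Continuous fun x => fderiv ℝ (F i) x (e i) :=
    ((hF i).continuous_fderiv (by simp)).clm_apply continuous_const
  have hz : ∫ x, ∑ i, fderiv ℝ (F i) x (e i) ∂cellMeasure d L = 0 := by
    rw [integral_finsetSum _ fun i _ => integrable_cellMeasure (hcF i)]
    exact Finset.sum_eq_zero fun i _ => (hFp i).integral_fderiv_apply hL (hF i) _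
  have c1 : Continuous fun x => ν * (Φ'' (v x) * gradSq v x) :=
    continuous_const.mul ((h3.comp hv1.continuous).mul (continuous_gradSq hv1))
  have c2 : Continuous fun x => Φ' (v x) * (ν * Δ v x - fderiv ℝ v x (V x)) := by
    have : (fun x => Φ' (v x) * (ν * Δ v x - fderiv ℝ v x (V x))) =
        fun x => ∑ i, fderiv ℝ (F i) x (e i) - ν * (Φ'' (v x) * gradSq v x) := by
      ext x; rw [hsum]; ring
    rw [this]
    exact (continuous_finsetSum _ fun i _ => hcF i).sub c1
  simp_rw [hsum] at hz
  rw [integral_add (integrable_cellMeasure c1) (integrable_cellMeasure c2),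
    integral_const_mul] at hz
  linarith

variable {u : ℝ → E d → E d} {θ₀ : E d → ℝ} {θ : ℝ → E d → ℝ}

theorem IsSolution.continuous (hθ : IsSolution L ν T u θ₀ θ) {t : ℝ} (ht : t ∈ Ioc 0 T) :
    Continuous (θ t) := by
  rw [← continuousOn_univ]
  exact hθ.continuousOn.comp (f := fun x => (t, x)) (by fun_prop) fun x _ => ⟨ht, mem_univ _⟩

/-- Carries monotonicity from the open interval, where the equation holds, to the endpoint T. -/
theorem IsSolution.continuousOn_integral (hθ : IsSolution L ν T u θ₀ θ) {Φ : ℝ → ℝ}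
    (hΦ : Continuous Φ) :
    ContinuousOn (fun s => ∫ x, Φ (θ s x) ∂cellMeasure d L) (Ioc 0 T) := by
  intro t ht
  -- Staying above t/2 gives a compact time strip on which the integrand is bounded; no such bound
  -- is known near time 0.
  have hsub : Icc (t / 2) T ⊆ Ioc 0 T := fun s hs => ⟨(half_pos ht.1).trans_le hs.1, hs.2⟩
  have hc : ContinuousOn (fun p : ℝ × E d => Φ (θ p.1 p.2)) (Icc (t / 2) T ×ˢ cell d L) :=
    hΦ.comp_continuousOn (hθ.continuousOn.mono (prod_mono hsub (subset_univ _)))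
  obtain ⟨C, hC⟩ :=
    ((isCompact_Icc (a := t / 2) (b := T)).prod (isCompact_cell d L)).exists_bound_of_continuousOn hc
  have hnear : ∀ᶠ s in 𝓝[Ioc 0 T] t, s ∈ Icc (t / 2) T := by
    filter_upwards [self_mem_nhdsWithin, mem_nhdsWithin_of_mem_nhds (Ioi_mem_nhds
      (half_lt_self ht.1))] with s hs hs'
    exact ⟨le_of_lt hs', hs.2⟩
  refine continuousWithinAt_of_dominated (bound := fun _ => C) ?_ ?_ (integrable_const _) ?_
  · filter_upwards [self_mem_nhdsWithin] with s hs
    exact (hΦ.comp (hθ.continuous hs)).aestronglyMeasurable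
  · filter_upwards [hnear] with s hs
    filter_upwards [ae_restrict_mem (measurableSet_cell d L)] with x hx
    exact hC (s, x) ⟨hs, hx⟩
  · refine Eventually.of_forall fun x => ?_
    exact hΦ.comp_continuousOn (hθ.continuousOn.comp (f := fun s => (s, x)) (by fun_prop)
      fun s hs => ⟨hs, mem_univ _⟩) t ht

/-- The energy identity. -/
theorem IsSolution.hasDerivAt_integral (hθ : IsSolution L ν T u θ₀ θ) (hL : 0 < L)
    (hu : IsIncompressibleDrift L T u) {Φ Φ' Φ'' : ℝ → ℝ} (h1 : ∀ y, HasDerivAt Φ (Φ' y) y)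
    (h2 : ∀ y, HasDerivAt Φ' (Φ'' y) y) (h3 : Continuous Φ'') {t : ℝ} (ht : t ∈ Ioo 0 T) :
    HasDerivAt (fun s => ∫ x, Φ (θ s x) ∂cellMeasure d L)
      (-ν * ∫ x, Φ'' (θ t x) * gradSq (θ t) x ∂cellMeasure d L) t := by
  have hΦ : Continuous Φ := continuous_iff_continuousAt.2 fun y => (h1 y).continuousAt
  have hΦ' : Continuous Φ' := continuous_iff_continuousAt.2 fun y => (h2 y).continuousAt
  have hts := Ioo_subset_Icc_self ht
  rw [← integral_mul_driftDiffusion hL (hθ.contDiff t ht) (hθ.periodic t (Ioo_subset_Ioc_self ht))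
    (hu.contDiff t hts) (hu.periodic t hts) (hu.divergence_eq_zero t hts) h1 h2 h3]
  let R (s : ℝ) (x : E d) : ℝ := Φ' (θ s x) * (ν * Δ (θ s) x - fderiv ℝ (θ s) x (u s x))
  have hR : ContinuousOn (fun p : ℝ × E d => R p.1 p.2) (Ioo 0 T ×ˢ univ) := by
    have hlap : ContinuousOn (fun p : ℝ × E d => Δ (θ p.1) p.2) (Ioo 0 T ×ˢ univ) := by
      simp_rw [InnerProductSpace.laplacian_eq_iteratedFDeriv_orthonormalBasis _
        (EuclideanSpace.basisFun (Fin d) ℝ)]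
      refine continuousOn_finsetSum _ fun i _ => ?_
      exact (continuous_eval_const (F := E d [×2]→L[ℝ] ℝ) _).comp_continuousOn
        hθ.continuousOn_iteratedFDeriv
    have hs1 : (Ioo 0 T ×ˢ univ : Set (ℝ × E d)) ⊆ Ioc 0 T ×ˢ univ :=
      prod_mono_left Ioo_subset_Ioc_self
    have hs2 : (Ioo 0 T ×ˢ univ : Set (ℝ × E d)) ⊆ Icc 0 T ×ˢ univ :=
      prod_mono_left Ioo_subset_Icc_self
    exact (hΦ'.comp_continuousOn (hθ.continuousOn.mono hs1)).mul
      ((continuousOn_const.mul hlap).sub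
        (hθ.continuousOn_fderiv.clm_apply (hu.continuousOn.mono hs2)))
  have hRs {s : ℝ} (hs : s ∈ Ioo 0 T) : Continuous (R s) := by
    rw [← continuousOn_univ]
    exact hR.comp (f := fun x => (s, x)) (by fun_prop) fun x _ => ⟨hs, mem_univ _⟩
  obtain ⟨ε, hε, hball⟩ := Metric.nhds_basis_closedBall.mem_iff.1 (Ioo_mem_nhds ht.1 ht.2)
  obtain ⟨C, hC⟩ := ((isCompact_closedBall t ε).prod (isCompact_cell d L)).exists_bound_of_continuousOn
    (hR.mono (prod_mono hball (subset_univ _)))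
  refine (hasDerivAt_integral_of_dominated_loc_of_deriv_le (F' := R) (bound := fun _ => C)
    (Metric.closedBall_mem_nhds t hε) ?_ ?_ (hRs ht).aestronglyMeasurable ?_
    (integrable_const _) ?_).2
  · filter_upwards [Ioo_mem_nhds ht.1 ht.2] with s hs
    exact (hΦ.comp (hθ.continuous (Ioo_subset_Ioc_self hs))).aestronglyMeasurable
  · exact integrable_cellMeasure (hΦ.comp (hθ.continuous (Ioo_subset_Ioc_self ht)))
  · filter_upwards [ae_restrict_mem (measurableSet_cell d L)] with x hx s hs
    exact hC (s, x) ⟨hs, hx⟩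
  · refine Eventually.of_forall fun x s hs => ?_
    obtain ⟨θt, hd, heq⟩ := hθ.equation s (hball hs) x
    have : θt = ν * Δ (θ s) x - fderiv ℝ (θ s) x (u s x) := by linarith
    rw [this] at hd
    exact (h1 (θ s x)).comp s hd

theorem IsSolution.antitoneOn_integral (hθ : IsSolution L ν T u θ₀ θ) (hL : 0 < L) (hν : 0 < ν)
    (hu : IsIncompressibleDrift L T u) {Φ Φ' Φ'' : ℝ → ℝ} (h1 : ∀ y, HasDerivAt Φ (Φ' y) y)
    (h2 : ∀ y, HasDerivAt Φ' (Φ'' y) y) (h3 : Continuous Φ'') (h4 : ∀ y, 0 ≤ Φ'' y) :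
    AntitoneOn (fun s => ∫ x, Φ (θ s x) ∂cellMeasure d L) (Ioc 0 T) := by
  have hΦ : Continuous Φ := continuous_iff_continuousAt.2 fun y => (h1 y).continuousAt
  have hd {t : ℝ} (ht : t ∈ interior (Ioc 0 T)) :=
    hθ.hasDerivAt_integral hL hu h1 h2 h3 (interior_Ioc (a := (0 : ℝ)) (b := T) ▸ ht)
  refine antitoneOn_of_deriv_nonpos (convex_Ioc 0 T) (hθ.continuousOn_integral hΦ)
    (fun t ht => (hd ht).differentiableAt.differentiableWithinAt) fun t ht => ?_
  rw [(hd ht).deriv]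
  have : 0 ≤ ∫ x, Φ'' (θ t x) * gradSq (θ t) x ∂cellMeasure d L :=
    integral_nonneg fun x => mul_nonneg (h4 _) (gradSq_nonneg _ _)
  nlinarith

/-! ### Passage to the initial data: mean value and maximum principle -/

theorem IsSolution.tendsto_integral_abs_sub (hθ : IsSolution L ν T u θ₀ θ) (hT : 0 < T)
    (h0 : AEStronglyMeasurable θ₀ (cellMeasure d L)) :
    Tendsto (fun t => ∫ x, |θ t x - θ₀ x| ∂cellMeasure d L) (𝓝[>] 0) (𝓝 0) := by
  have h := (ENNReal.tendsto_toReal ENNReal.zero_ne_top).comp hθ.initial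
  rw [ENNReal.toReal_zero] at h
  refine h.congr' ?_
  filter_upwards [Ioc_mem_nhdsGT hT] with t ht
  have hm : AEStronglyMeasurable (fun x => θ t x - θ₀ x) (cellMeasure d L) :=
    (hθ.continuous ht).aestronglyMeasurable.sub h0
  simp only [Function.comp, eLpNorm_one_eq_lintegral_enorm, ← Real.norm_eq_abs]
  rw [integral_norm_eq_lintegral_enorm hm]

theorem IsInitialData.integrable (h0 : IsInitialData L θ₀) : Integrable θ₀ (cellMeasure d L) :=
  h0.memLp.integrable le_top

/-- Convex Lipschitz functionals do not exceed their initial value. -/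
theorem IsSolution.integral_le_initial (hθ : IsSolution L ν T u θ₀ θ) (hL : 0 < L) (hν : 0 < ν)
    (hT : 0 < T) (hu : IsIncompressibleDrift L T u) (h0 : Integrable θ₀ (cellMeasure d L))
    {Φ Φ' Φ'' : ℝ → ℝ} (h1 : ∀ y, HasDerivAt Φ (Φ' y) y)
    (h2 : ∀ y, HasDerivAt Φ' (Φ'' y) y) (h3 : Continuous Φ'') (h4 : ∀ y, 0 ≤ Φ'' y)
    {K : ℝ} (hK : ∀ a b, |Φ a - Φ b| ≤ K * |a - b|) {t : ℝ} (ht : t ∈ Ioc 0 T) :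
    ∫ x, Φ (θ t x) ∂cellMeasure d L ≤ ∫ x, Φ (θ₀ x) ∂cellMeasure d L := by
  have hΦ : Continuous Φ := continuous_iff_continuousAt.2 fun y => (h1 y).continuousAt
  have hi0 : Integrable (fun x => Φ (θ₀ x)) (cellMeasure d L) := by
    refine ((integrable_const |Φ 0|).add (h0.abs.const_mul K)).mono'
      (hΦ.comp_aestronglyMeasurable h0.aestronglyMeasurable) (Eventually.of_forall fun x => ?_)
    have := hK (θ₀ x) 0
    rw [sub_zero] at this
    have h' := abs_sub_abs_le_abs_sub (Φ (θ₀ x)) (Φ 0)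
    simp only [Real.norm_eq_abs, Pi.add_apply]
    linarith
  -- The data are attained only in L¹, so the Lipschitz bound on Φ is what makes the error at time s
  -- vanish as s ↓ 0.
  have hlim := ((hθ.tendsto_integral_abs_sub hT h0.aestronglyMeasurable).const_mul K).const_add
    (∫ x, Φ (θ₀ x) ∂cellMeasure d L)
  rw [mul_zero, add_zero] at hlim
  refine ge_of_tendsto hlim ?_
  filter_upwards [Ioc_mem_nhdsGT ht.1] with s hs
  have hs' : s ∈ Ioc 0 T := ⟨hs.1, hs.2.trans ht.2⟩
  refine (hθ.antitoneOn_integral hL hν hu h1 h2 h3 h4 hs' ht hs.2).trans ?_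
  have hi1 : Integrable (fun x => |θ s x - θ₀ x|) (cellMeasure d L) :=
    ((integrable_cellMeasure (hθ.continuous hs')).sub h0).abs
  rw [← integral_const_mul, ← integral_add hi0 (hi1.const_mul K)]
  refine integral_mono (integrable_cellMeasure (hΦ.comp (hθ.continuous hs')))
    (hi0.add (hi1.const_mul K)) fun x => ?_
  have := (le_abs_self _).trans (hK (θ s x) (θ₀ x))
  linarith

theorem IsSolution.integral_eq_zero (hθ : IsSolution L ν T u θ₀ θ) (hL : 0 < L) (hν : 0 < ν)
    (hT : 0 < T) (hu : IsIncompressibleDrift L T u) (h0 : IsInitialData L θ₀) {t : ℝ}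
    (ht : t ∈ Ioc 0 T) : ∫ x, θ t x ∂cellMeasure d L = 0 := by
  -- Linear functions are convex with both signs, so the mean can neither grow nor fall.
  have key (σ : ℝ) : ∫ x, σ * θ t x ∂cellMeasure d L ≤ 0 := by
    have := hθ.integral_le_initial hL hν hT hu h0.integrable (Φ := fun y => σ * y)
      (Φ' := fun _ => σ) (Φ'' := fun _ => 0)
      (fun y => by simpa using (hasDerivAt_id y).const_mul σ)
      (fun y => hasDerivAt_const y σ) continuous_const (fun _ => le_rfl) (K := |σ|)
      (fun a b => by rw [← mul_sub, abs_mul]) ht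
    rwa [integral_const_mul, integral_const_mul, h0.mean_zero, mul_zero,
      ← integral_const_mul] at this
  have k1 := key 1
  have k2 := key (-1)
  rw [integral_const_mul] at k1 k2
  linarith

/-- The root is the length of the vector (√δ, p), and length is 1-Lipschitz. This makes the smoothed
positive part admissible in `integral_le_initial`. -/
theorem abs_sqrt_add_sq_sub_le {δ : ℝ} (hδ : 0 < δ) (p q : ℝ) :
    |√(δ + p ^ 2) - √(δ + q ^ 2)| ≤ |p - q| := by
  have key (p q : ℝ) : √(δ + p ^ 2) ≤ √(δ + q ^ 2) + |p - q| := by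
    have h1 : |q| ≤ √(δ + q ^ 2) := Real.abs_le_sqrt (by linarith)
    refine Real.sqrt_le_iff.2 ⟨by positivity, ?_⟩
    have h2 : √(δ + q ^ 2) ^ 2 = δ + q ^ 2 := Real.sq_sqrt (by positivity)
    have h3 : q * (p - q) ≤ √(δ + q ^ 2) * |p - q| :=
      (le_abs_self _).trans (by rw [abs_mul]; gcongr)
    nlinarith [sq_abs (p - q)]
  rw [abs_sub_le_iff]
  have := key q p
  rw [abs_sub_comm] at this
  constructor <;> linarith [key p q]

/-- One-sided maximum principle (for `σ = 1` and `σ = -1`). -/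
theorem IsSolution.ae_mul_le (hθ : IsSolution L ν T u θ₀ θ) (hL : 0 < L) (hν : 0 < ν)
    (hT : 0 < T) (hu : IsIncompressibleDrift L T u) (h0 : IsInitialData L θ₀) {σ m : ℝ}
    (hm : ∀ᵐ x ∂cellMeasure d L, σ * θ₀ x ≤ m) {t : ℝ} (ht : t ∈ Ioc 0 T) :
    ∀ᵐ x ∂cellMeasure d L, σ * θ t x ≤ m := by
  have hct := hθ.continuous ht
  have hδ (δ : ℝ) (hδ : 0 < δ) :
      ∫ x, max (σ * θ t x - m) 0 ∂cellMeasure d L ≤ √δ * L ^ d := by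
    -- With s = σy - m, the function √(δ + s²) + s is a smooth convex Lipschitz version of twice the
    -- positive part of s. It dominates max(s, 0), and it is at most √δ where s ≤ 0, as holds for
    -- the data.
    let r (y : ℝ) : ℝ := √(δ + (σ * y - m) ^ 2)
    have hpos (y : ℝ) : 0 < δ + (σ * y - m) ^ 2 := by positivity
    have hr (y : ℝ) : 0 < r y := Real.sqrt_pos.2 (hpos y)
    have hr2 (y : ℝ) : r y ^ 2 = δ + (σ * y - m) ^ 2 := Real.sq_sqrt (hpos y).le
    have hlin (y : ℝ) : HasDerivAt (fun y => σ * y - m) σ y := by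
      simpa using ((hasDerivAt_id y).const_mul σ).sub_const m
    have hrd (y : ℝ) : HasDerivAt r (σ * (σ * y - m) / r y) y := by
      have h : HasDerivAt r ((2 : ℕ) * (σ * y - m) ^ (2 - 1) * σ / (2 * r y)) y :=
        (((hlin y).pow 2).const_add δ).sqrt (hpos y).ne'
      convert h using 1
      have := (hr y).ne'
      field_simp
      push_cast
      ring
    have hrc : Continuous r := continuous_iff_continuousAt.2 fun y => (hrd y).continuousAt
    have hmain := hθ.integral_le_initial hL hν hT hu h0.integrable
      (Φ := fun y => r y + (σ * y - m)) (Φ' := fun y => σ * (σ * y - m) / r y + σ)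
      (Φ'' := fun y => σ ^ 2 * δ / r y ^ 3)
      (fun y => (hrd y).add (hlin y))
      (fun y => by
        have h : HasDerivAt (fun y => σ * (σ * y - m) / r y + σ)
            ((σ * σ * r y - σ * (σ * y - m) * (σ * (σ * y - m) / r y)) / r y ^ 2) y :=
          (((hlin y).const_mul σ).div (hrd y) (hr y).ne').add_const σ
        convert h using 1
        have := (hr y).ne'
        have h2 := hr2 y
        field_simp
        rw [h2]
        ring)
      (continuous_const.div (hrc.pow 3) fun y => (pow_pos (hr y) 3).ne')
      (fun y => div_nonneg (by positivity) (pow_pos (hr y) 3).le)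
      (K := 2 * |σ|)
      (fun a b => by
        have h5 := abs_sqrt_add_sq_sub_le hδ (σ * a - m) (σ * b - m)
        have h6 : σ * a - m - (σ * b - m) = σ * (a - b) := by ring
        rw [h6, abs_mul] at h5
        calc |r a + (σ * a - m) - (r b + (σ * b - m))| = |(r a - r b) + σ * (a - b)| := by ring_nf
          _ ≤ |r a - r b| + |σ * (a - b)| := abs_add_le _ _
          _ ≤ |σ| * |a - b| + |σ| * |a - b| := by rw [abs_mul]; exact add_le_add h5 le_rfl
          _ = 2 * |σ| * |a - b| := by ring) ht
    have hub : ∫ x, (r (θ₀ x) + (σ * θ₀ x - m)) ∂cellMeasure d L ≤ √δ * L ^ d := by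
      have hc : ∫ _x, √δ ∂cellMeasure d L = √δ * L ^ d := by
        rw [integral_const, cellMeasure_real_univ d hL.le, smul_eq_mul, mul_comm]
      rw [← hc]
      refine integral_mono_of_nonneg (Eventually.of_forall fun x => ?_) (integrable_const _) ?_
      · have := Real.abs_le_sqrt (x := σ * θ₀ x - m) (y := δ + (σ * θ₀ x - m) ^ 2) (by linarith)
        have h7 := neg_abs_le (σ * θ₀ x - m)
        simp only [r, Pi.zero_apply]
        linarith
      · filter_upwards [hm] with x hx
        have : r (θ₀ x) ≤ √δ + (m - σ * θ₀ x) := by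
          refine Real.sqrt_le_iff.2 ⟨by positivity, ?_⟩
          have := Real.sq_sqrt hδ.le
          nlinarith [mul_nonneg (Real.sqrt_nonneg δ) (sub_nonneg.2 hx)]
        linarith
    refine (integral_mono (integrable_cellMeasure (by fun_prop))
      (integrable_cellMeasure (f := fun x => r (θ t x) + (σ * θ t x - m)) (by fun_prop))
      fun x => ?_).trans (hmain.trans hub)
    have := Real.abs_le_sqrt (x := σ * θ t x - m) (y := δ + (σ * θ t x - m) ^ 2) (by linarith)
    have h7 := neg_abs_le (σ * θ t x - m)
    have h8 := le_abs_self (σ * θ t x - m)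
    have h9 := (abs_nonneg (σ * θ t x - m)).trans this
    refine max_le ?_ ?_ <;> simp only [r]
    · by_cases hs : 0 ≤ σ * θ t x - m <;> linarith
    · linarith
  have hle : ∫ x, max (σ * θ t x - m) 0 ∂cellMeasure d L ≤ 0 := by
    have hlim : Tendsto (fun δ : ℝ => √δ * L ^ d) (𝓝[>] 0) (𝓝 0) := by
      have : Continuous fun δ : ℝ => √δ * L ^ d := by fun_prop
      simpa using (this.tendsto 0).mono_left nhdsWithin_le_nhds
    refine ge_of_tendsto hlim ?_
    filter_upwards [self_mem_nhdsWithin] with δ h using hδ δ h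
  have heq := le_antisymm hle (integral_nonneg fun x => le_max_right _ _)
  have hnn : (0 : E d → ℝ) ≤ fun x => max (σ * θ t x - m) 0 := fun x => le_max_right _ _
  rw [integral_eq_zero_iff_of_nonneg hnn (integrable_cellMeasure (by fun_prop))] at heq
  filter_upwards [heq] with x hx
  simpa using hx

theorem IsSolution.ae_abs_le (hθ : IsSolution L ν T u θ₀ θ) (hL : 0 < L) (hν : 0 < ν)
    (hT : 0 < T) (hu : IsIncompressibleDrift L T u) (h0 : IsInitialData L θ₀) {m : ℝ}
    (hm : ∀ᵐ x ∂cellMeasure d L, |θ₀ x| ≤ m) {t : ℝ} (ht : t ∈ Ioc 0 T) :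
    ∀ᵐ x ∂cellMeasure d L, |θ t x| ≤ m := by
  have h1 := hθ.ae_mul_le hL hν hT hu h0 (σ := 1) (m := m)
    (hm.mono fun x hx => by linarith [le_abs_self (θ₀ x)]) ht
  have h2 := hθ.ae_mul_le hL hν hT hu h0 (σ := -1) (m := m)
    (hm.mono fun x hx => by linarith [neg_abs_le (θ₀ x)]) ht
  filter_upwards [h1, h2] with x hx hx'
  exact abs_le.2 ⟨by linarith, by linarith⟩

/-! ### Even moments: dissipation and relaxation -/

theorem gradSq_pow {v : E d → ℝ} (hv : ContDiff ℝ 1 v) (p : ℕ) (x : E d) :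
    gradSq (fun y => v y ^ p) x = p ^ 2 * v x ^ (2 * (p - 1)) * gradSq v x := by
  have h := (((hv.differentiable (by simp) x).hasFDerivAt).pow p).fderiv
  simp only [gradSq, Finset.mul_sum]
  refine Finset.sum_congr rfl fun i _ => ?_
  have h' : fderiv ℝ (fun y => v y ^ p) x = _ := h
  rw [h']
  simp
  ring

/-- Dissipation of an even moment, in terms of the gradient of its square root. -/
theorem IsSolution.exists_hasDerivAt_moment (hθ : IsSolution L ν T u θ₀ θ) (hL : 0 < L)
    (hν : 0 < ν) (hu : IsIncompressibleDrift L T u) {p : ℕ} (hp : 1 ≤ p) {t : ℝ}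
    (ht : t ∈ Ioo 0 T) :
    ∃ y', HasDerivAt (fun s => ∫ x, (θ s x ^ p) ^ 2 ∂cellMeasure d L) y' t ∧
      y' ≤ -(2 * ν) * ∫ x, gradSq (fun y => θ t y ^ p) x ∂cellMeasure d L := by
  have hv : ContDiff ℝ 1 (θ t) := (hθ.contDiff t ht).of_le (by norm_num)
  obtain ⟨q, rfl⟩ : ∃ q, p = q + 1 := ⟨p - 1, by omega⟩
  have h := hθ.hasDerivAt_integral hL hu (Φ := fun y => (y ^ (q + 1)) ^ 2)
    (Φ' := fun y => (2 * q + 2) * y ^ (2 * q + 1))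
    (Φ'' := fun y => (2 * q + 2) * (2 * q + 1) * y ^ (2 * q))
    (fun y => by
      have e : (fun y : ℝ => (y ^ (q + 1)) ^ 2) = fun y => y ^ (2 * q + 2) := by ext y; ring
      rw [e]
      exact (hasDerivAt_pow (2 * q + 2) y).congr_deriv (by push_cast; rfl))
    (fun y => ((hasDerivAt_pow (2 * q + 1) y).const_mul (2 * (q : ℝ) + 2)).congr_deriv
      (by rw [Nat.add_sub_cancel]; push_cast; ring)) (by fun_prop) ht
  refine ⟨_, h, ?_⟩
  simp only [gradSq_pow hv, Nat.add_sub_cancel, mul_assoc]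
  rw [integral_const_mul, integral_const_mul, integral_const_mul]
  have hI : 0 ≤ ∫ x, θ t x ^ (2 * q) * gradSq (θ t) x ∂cellMeasure d L :=
    integral_nonneg fun x => mul_nonneg (Even.pow_nonneg (even_two_mul q) _) (gradSq_nonneg _ _)
  push_cast
  have h2 : 0 ≤ ν * ∫ x, θ t x ^ (2 * q) * gradSq (θ t) x ∂cellMeasure d L := by positivity
  -- With p = q + 1 the exact coefficient is 2p(2p-1), which exceeds the claimed 2p² by 2q(q+1) ≥ 0.
  have h3 : 0 ≤ (q : ℝ) * (q + 1) := by positivity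
  nlinarith [mul_nonneg h3 h2]

/-- Grönwall: exp(κt)(y - B) is nonincreasing. The favourable term -exp(-κ(b-a))B is dropped. -/
theorem le_exp_mul_add_of_deriv_le {y : ℝ → ℝ} {a b κ B : ℝ} (hab : a ≤ b) (hB : 0 ≤ B)
    (hy : ContinuousOn y (Icc a b))
    (hd : ∀ t ∈ Ioo a b, ∃ y', HasDerivAt y y' t ∧ y' ≤ -κ * (y t - B)) :
    y b ≤ Real.exp (-(κ * (b - a))) * y a + B := by
  have hanti : AntitoneOn (fun t => Real.exp (κ * t) * (y t - B)) (Icc a b) := by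
    have hder {t y' : ℝ} (h : HasDerivAt y y' t) :
        HasDerivAt (fun t => Real.exp (κ * t) * (y t - B))
          (Real.exp (κ * t) * κ * (y t - B) + Real.exp (κ * t) * y') t := by
      have h1 : HasDerivAt (fun t => κ * t) κ t := by simpa using (hasDerivAt_id t).const_mul κ
      exact h1.exp.mul (h.sub_const B)
    refine antitoneOn_of_deriv_nonpos (convex_Icc a b) (by fun_prop) (fun t ht => ?_)
      fun t ht => ?_
    all_goals
      rw [interior_Icc] at ht
      obtain ⟨y', h1, h2⟩ := hd t ht
    · exact (hder h1).differentiableAt.differentiableWithinAt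
    · rw [(hder h1).deriv]
      have := mul_le_mul_of_nonneg_left h2 (Real.exp_pos (κ * t)).le
      linarith
  have h := hanti (left_mem_Icc.2 hab) (right_mem_Icc.2 hab) hab
  simp only at h
  have h1 : Real.exp (κ * b) * (y b - B) ≤
      Real.exp (κ * b) * (Real.exp (-(κ * (b - a))) * (y a - B)) := by
    rwa [← mul_assoc, ← Real.exp_add, show κ * b + -(κ * (b - a)) = κ * a by ring]
  have h2 := le_of_mul_le_mul_left h1 (Real.exp_pos _)
  nlinarith [mul_nonneg (Real.exp_pos (-(κ * (b - a)))).le hB]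

theorem IsSolution.continuousOn_moment (hθ : IsSolution L ν T u θ₀ θ) (p : ℕ) :
    ContinuousOn (fun s => ∫ x, (θ s x ^ p) ^ 2 ∂cellMeasure d L) (Ioc 0 T) :=
  hθ.continuousOn_integral (Φ := fun y => (y ^ p) ^ 2) (by fun_prop)

theorem IsSolution.antitoneOn_moment (hθ : IsSolution L ν T u θ₀ θ) (hL : 0 < L)
    (hν : 0 < ν) (hu : IsIncompressibleDrift L T u) {p : ℕ} (hp : 1 ≤ p) :
    AntitoneOn (fun s => ∫ x, (θ s x ^ p) ^ 2 ∂cellMeasure d L) (Ioc 0 T) := by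
  refine antitoneOn_of_deriv_nonpos (convex_Ioc 0 T) (hθ.continuousOn_moment p) (fun t ht => ?_)
    fun t ht => ?_
  all_goals
    rw [interior_Ioc] at ht
    obtain ⟨y', h1, h2⟩ := hθ.exists_hasDerivAt_moment hL hν hu hp ht
  · exact h1.differentiableAt.differentiableWithinAt
  · rw [h1.deriv]
    have : 0 ≤ ∫ x, gradSq (fun y => θ t y ^ p) x ∂cellMeasure d L :=
      integral_nonneg fun x => gradSq_nonneg _ _
    nlinarith

/-- Exponential decay of the `L²` norm. -/
theorem IsSolution.integral_sq_le (hθ : IsSolution L ν T u θ₀ θ) (hd : 0 < d) (hL : 0 < L)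
    (hν : 0 < ν) (hT : 0 < T) (hu : IsIncompressibleDrift L T u) (h0 : IsInitialData L θ₀) {m : ℝ}
    (hm : ∀ᵐ x ∂cellMeasure d L, |θ₀ x| ≤ m) {t : ℝ} (ht : t ∈ Ioc 0 T) :
    ∫ x, θ t x ^ 2 ∂cellMeasure d L ≤
      Real.exp (-(4 * ν / (d * L ^ 2) * t)) * (L ^ d * m ^ 2) := by
  have hd' : (0 : ℝ) < d := by exact_mod_cast hd
  -- The dissipation factor 2ν divided by the Poincaré constant dL²/2.
  set κ := 4 * ν / (d * L ^ 2) with hκ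
  -- The square is not Lipschitz, so the decay is started at a positive time s, where the maximum
  -- principle bounds the L² norm by the data; then s ↓ 0.
  have hstep : ∀ s ∈ Ioc 0 t, ∫ x, θ t x ^ 2 ∂cellMeasure d L ≤
      Real.exp (-(κ * (t - s))) * (L ^ d * m ^ 2) := by
    intro s hs
    have hsT : s ∈ Ioc 0 T := ⟨hs.1, hs.2.trans ht.2⟩
    have h1 := le_exp_mul_add_of_deriv_le (y := fun s => ∫ x, θ s x ^ 2 ∂cellMeasure d L)
      (κ := κ) hs.2 le_rfl
      ((hθ.continuousOn_integral (Φ := fun y => y ^ 2) (by fun_prop)).mono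
        fun r hr => ⟨hs.1.trans_le hr.1, hr.2.trans ht.2⟩)
      (fun r hr => by
        have hr' : r ∈ Ioo 0 T := ⟨hs.1.trans hr.1, hr.2.trans_le ht.2⟩
        have hrc := Ioo_subset_Ioc_self hr'
        obtain ⟨y', e1, e2⟩ := hθ.exists_hasDerivAt_moment hL hν hu le_rfl hr'
        simp only [pow_one] at e1 e2
        refine ⟨y', e1, e2.trans ?_⟩
        have hp := (hθ.periodic r hrc).poincare hL ((hθ.contDiff r hr').of_le (by norm_num))
          (hθ.integral_eq_zero hL hν hT hu h0 hrc)
        have : κ * ∫ x, θ r x ^ 2 ∂cellMeasure d L ≤ _ :=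
          mul_le_mul_of_nonneg_left hp (by positivity)
        have h3 : κ * (d * L ^ 2 / 2 * ∫ x, gradSq (θ r) x ∂cellMeasure d L) =
          2 * ν * ∫ x, gradSq (θ r) x ∂cellMeasure d L := by
            rw [hκ]; field_simp; norm_num
        rw [h3] at this
        linarith)
    refine h1.trans ?_
    rw [add_zero]
    refine mul_le_mul_of_nonneg_left ?_ (Real.exp_pos _).le
    have hc : ∫ _x, m ^ 2 ∂cellMeasure d L = L ^ d * m ^ 2 := by
      rw [integral_const, cellMeasure_real_univ d hL.le, smul_eq_mul]
    rw [← hc]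
    refine integral_mono_of_nonneg (Eventually.of_forall fun x => sq_nonneg _)
      (integrable_const _) ?_
    filter_upwards [hθ.ae_abs_le hL hν hT hu h0 hm hsT] with x hx
    exact sq_le_sq' (abs_le.1 hx).1 (abs_le.1 hx).2
  have hlim : Tendsto (fun s : ℝ => Real.exp (-(κ * (t - s))) * (L ^ d * m ^ 2)) (𝓝[>] 0)
      (𝓝 (Real.exp (-(κ * t)) * (L ^ d * m ^ 2))) := by
    have : Continuous fun s : ℝ => Real.exp (-(κ * (t - s))) * (L ^ d * m ^ 2) := by fun_prop
    simpa using (this.tendsto 0).mono_left nhdsWithin_le_nhds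
  refine ge_of_tendsto hlim ?_
  filter_upwards [Ioc_mem_nhdsGT ht.1] with s hs using hstep s hs

/-- One step of the Moser iteration. -/
theorem IsSolution.moment_step (hθ : IsSolution L ν T u θ₀ θ) (hd : 0 < d) (hL : 0 < L)
    (hν : 0 < ν) (hu : IsIncompressibleDrift L T u) {h : ℝ} (hh : 0 < h) (hhL : h ≤ L) {p : ℕ}
    (hp : 1 ≤ p) {a b : ℝ} (ha : 0 < a) (hab : a ≤ b) (hb : b ≤ T) :
    ∫ x, (θ b x ^ (2 * p)) ^ 2 ∂cellMeasure d L ≤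
      Real.exp (-(4 * ν / (d * h ^ 2) * (b - a))) *
        ∫ x, (θ a x ^ (2 * p)) ^ 2 ∂cellMeasure d L +
      (∫ x, (θ a x ^ p) ^ 2 ∂cellMeasure d L) ^ 2 / h ^ d := by
  have hd' : (0 : ℝ) < d := by exact_mod_cast hd
  refine le_exp_mul_add_of_deriv_le (y := fun s => ∫ x, (θ s x ^ (2 * p)) ^ 2 ∂cellMeasure d L)
    hab (by positivity) ((hθ.continuousOn_moment (2 * p)).mono
      fun r hr => ⟨ha.trans_le hr.1, hr.2.trans hb⟩) fun r hr => ?_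
  have hr' : r ∈ Ioo 0 T := ⟨ha.trans hr.1, hr.2.trans_le hb⟩
  have hrc := Ioo_subset_Ioc_self hr'
  obtain ⟨y', e1, e2⟩ := hθ.exists_hasDerivAt_moment hL hν hu (p := 2 * p) (by omega) hr'
  refine ⟨y', e1, e2.trans ?_⟩
  have hvp : IsPeriodic L fun x => θ r x ^ (2 * p) :=
    fun x i => by simp only [hθ.periodic r hrc x i]
  have hn := hvp.nash (((hθ.contDiff r hr').of_le (by norm_num)).pow _) hh hhL
  have habs (x : E d) : |θ r x ^ (2 * p)| = (θ r x ^ p) ^ 2 := by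
    rw [abs_of_nonneg (Even.pow_nonneg (even_two_mul p) _), mul_comm, pow_mul]
  simp only [habs] at hn
  -- The L¹ norm of w = θ^(2p) is itself a decreasing even moment, so the forcing can be frozen at
  -- its value at time a.
  have hmono : ∫ x, (θ r x ^ p) ^ 2 ∂cellMeasure d L ≤ ∫ x, (θ a x ^ p) ^ 2 ∂cellMeasure d L :=
    hθ.antitoneOn_moment hL hν hu hp ⟨ha, (hab.trans hb)⟩ hrc hr.1.le
  have hsq : (∫ x, (θ r x ^ p) ^ 2 ∂cellMeasure d L) ^ 2 / h ^ d ≤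
      (∫ x, (θ a x ^ p) ^ 2 ∂cellMeasure d L) ^ 2 / h ^ d := by
    have : 0 ≤ ∫ x, (θ r x ^ p) ^ 2 ∂cellMeasure d L := integral_nonneg fun x => sq_nonneg _
    gcongr
  have hκ : 0 ≤ 4 * ν / (d * h ^ 2) := by positivity
  have h5 := mul_le_mul_of_nonneg_left (sub_le_iff_le_add.2 (hn.trans (add_le_add le_rfl hsq))) hκ
  have h6 : 4 * ν / (d * h ^ 2) *
      (d * h ^ 2 / 2 * ∫ x, gradSq (fun y => θ r y ^ (2 * p)) x ∂cellMeasure d L) =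
      2 * ν * ∫ x, gradSq (fun y => θ r y ^ (2 * p)) x ∂cellMeasure d L := by
    field_simp; norm_num
  rw [h6] at h5
  linarith

/-! ### Moser iteration and exponential decay of the supremum -/

/-- Put A_k = 2·2^d·2^(kd) M_k / V. This normalisation turns the quadratic term into exactly A_k²/2,
leaving the other half of the squared bound for the linear term, which fits because q ≤ 1 and 2·2^d
≤ (2^(d+1))^(2^k). Thus the bound for A_k simply squares at each step. -/
theorem moser_recursion {M : ℕ → ℝ} {V m q : ℝ} (d : ℕ) (hM : ∀ k, 0 ≤ M k) (hV : 0 < V)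
    (hm : 0 ≤ m) (hq : 0 ≤ q) (hq1 : q ≤ 1) (h1 : M 1 ≤ q ^ 2 * (V * m ^ 2))
    (hstep : ∀ k, 1 ≤ k →
      M (k + 1) ≤ q ^ (2 ^ (k + 1)) * (m ^ 2 ^ k * M k) + (2 ^ k) ^ d * M k ^ 2 / V) {k : ℕ}
    (hk : 1 ≤ k) : M k * (2 ^ k) ^ d * 2 ^ d * 2 ≤ V * (2 ^ (d + 1) * q * m) ^ 2 ^ k := by
  induction k, hk using Nat.le_induction with
  | base =>
    have : (0 : ℝ) ≤ 2 ^ d := by positivity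
    calc M 1 * (2 ^ 1) ^ d * 2 ^ d * 2 ≤ q ^ 2 * (V * m ^ 2) * (2 ^ 1) ^ d * 2 ^ d * 2 := by gcongr
      _ ≤ 2 * (q ^ 2 * (V * m ^ 2) * (2 ^ 1) ^ d * 2 ^ d * 2) := by
        have : 0 ≤ q ^ 2 * (V * m ^ 2) * (2 ^ 1) ^ d * 2 ^ d * 2 := by positivity
        linarith
      _ = _ := by ring
  | succ k hk ih =>
    set P := q ^ 2 ^ k
    set Q := m ^ 2 ^ k
    set R := ((2 : ℝ) ^ (d + 1)) ^ 2 ^ k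
    set D : ℝ := (2 ^ k) ^ d
    set F : ℝ := 2 ^ d
    have hD : 0 ≤ D := by positivity
    have hF : 0 ≤ F := by positivity
    have hP : 0 ≤ P := by positivity
    have hQ : 0 ≤ Q := by positivity
    have hR : 0 ≤ R := by positivity
    have hP1 : P ≤ 1 := pow_le_one₀ hq hq1
    have hFR : 2 * F ≤ R := by
      have : (2 : ℝ) ^ (d + 1) ≤ R :=
        le_self_pow₀ (one_le_pow₀ one_le_two) (by positivity)
      calc 2 * F = 2 ^ (d + 1) := (pow_succ' 2 d).symm
        _ ≤ R := this
    have e1 : (2 ^ (d + 1) * q * m) ^ 2 ^ k = R * P * Q := by rw [mul_pow, mul_pow]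
    have e2 : (2 ^ (d + 1) * q * m) ^ 2 ^ (k + 1) = (R * P * Q) ^ 2 := by
      rw [pow_succ 2 k, pow_mul, e1]
    have e3 : q ^ 2 ^ (k + 1) = P ^ 2 := by rw [pow_succ 2 k, pow_mul]
    have e4 : ((2 : ℝ) ^ (k + 1)) ^ d = D * F := by rw [pow_succ, mul_pow]
    rw [e1] at ih
    have hs := hstep k hk
    rw [e3] at hs
    rw [e2, e4]
    have hMk := hM k
    have i1 : P ^ 2 * Q * F * (M k * D * F * 2) ≤ V * (R * P * Q) ^ 2 / 2 := by
      calc P ^ 2 * Q * F * (M k * D * F * 2) ≤ P ^ 2 * Q * F * (V * (R * P * Q)) := by gcongr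
        _ = P ^ 2 * Q ^ 2 * V * R * F * P := by ring
        _ ≤ P ^ 2 * Q ^ 2 * V * R * (R / 2) * 1 := by
          have : F ≤ R / 2 := by linarith
          gcongr
        _ = _ := by ring
    have i2 : (M k * D * F * 2) ^ 2 / (2 * V) ≤ V * (R * P * Q) ^ 2 / 2 := by
      calc (M k * D * F * 2) ^ 2 / (2 * V) ≤ (V * (R * P * Q)) ^ 2 / (2 * V) := by gcongr
        _ = _ := by field_simp
    calc M (k + 1) * (D * F) * F * 2
        ≤ (P ^ 2 * (Q * M k) + D * M k ^ 2 / V) * (D * F) * F * 2 := by gcongr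
      _ = P ^ 2 * Q * F * (M k * D * F * 2) + (M k * D * F * 2) ^ 2 / (2 * V) := by
        field_simp
      _ ≤ _ := by linarith

/-- Markov's inequality at any level c' > c bounds the measure of {c' ≤ |f|} by V(c/c')^(2^k), which
tends to 0; the prefactor V plays no role in the limit. -/
theorem ae_abs_le_of_forall_integral_pow_le {X : Type*} [MeasurableSpace X] {μ : Measure X}
    [IsFiniteMeasure μ] {f : X → ℝ} {V c : ℝ} (hc : 0 ≤ c)
    (hi : ∀ k : ℕ, Integrable (fun x => f x ^ 2 ^ k) μ)
    (h : ∀ k : ℕ, 1 ≤ k → ∫ x, f x ^ 2 ^ k ∂μ ≤ V * c ^ 2 ^ k) : ∀ᵐ x ∂μ, |f x| ≤ c := by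
  have key (n : ℕ) : ∀ᵐ x ∂μ, |f x| < c + 1 / (n + 1) := by
    set c' : ℝ := c + 1 / (n + 1)
    have hcc : c < c' := lt_add_of_pos_right _ (by positivity)
    have hc' : 0 < c' := hc.trans_lt hcc
    have hbd : ∀ k : ℕ, 1 ≤ k → μ.real {x | c' ≤ |f x|} ≤ V * (c / c') ^ 2 ^ k := by
      intro k hk
      have hev : Even (2 ^ k) := (Nat.even_pow.2 ⟨even_two, by omega⟩)
      have h1 := mul_meas_ge_le_integral_of_nonneg (Eventually.of_forall fun x => hev.pow_nonneg _)
        (hi k) (c' ^ 2 ^ k)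
      have h2 : {x | c' ≤ |f x|} ⊆ {x | c' ^ 2 ^ k ≤ f x ^ 2 ^ k} := fun x hx => by
        have := pow_le_pow_left₀ hc'.le hx (2 ^ k)
        rwa [hev.pow_abs] at this
      have h3 : c' ^ 2 ^ k * μ.real {x | c' ≤ |f x|} ≤ V * c ^ 2 ^ k :=
        (mul_le_mul_of_nonneg_left (measureReal_mono h2) (by positivity)).trans (h1.trans (h k hk))
      rw [div_pow, ← mul_div_assoc, le_div_iff₀ (by positivity)]
      linarith
    have hlim : Tendsto (fun k : ℕ => V * (c / c') ^ 2 ^ k) atTop (𝓝 0) := by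
      have h1 := (tendsto_pow_atTop_nhds_zero_of_lt_one (div_nonneg hc hc'.le)
        ((div_lt_one hc').2 hcc)).comp (tendsto_pow_atTop_atTop_of_one_lt (one_lt_two (α := ℕ)))
      simpa using h1.const_mul V
    have hz : μ.real {x | c' ≤ |f x|} ≤ 0 := by
      refine ge_of_tendsto hlim ?_
      filter_upwards [eventually_ge_atTop 1] with k hk using hbd k hk
    have hz' := le_antisymm hz measureReal_nonneg
    rw [measureReal_eq_zero_iff] at hz'
    rw [ae_iff]
    simpa only [not_lt] using hz'
  filter_upwards [ae_all_iff.2 key] with x hx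
  refine le_of_forall_pos_le_add fun ε hε => ?_
  obtain ⟨n, hn⟩ := exists_nat_one_div_lt hε
  linarith [hx n]

/-- Exponential decay in the supremum norm. -/
theorem IsSolution.ae_abs_le_exp (hθ : IsSolution L ν T u θ₀ θ) (hd : 0 < d) (hL : 0 < L)
    (hν : 0 < ν) (hT : 0 < T) (hu : IsIncompressibleDrift L T u) (h0 : IsInitialData L θ₀) {m : ℝ}
    (hm0 : 0 ≤ m) (hm : ∀ᵐ x ∂cellMeasure d L, |θ₀ x| ≤ m) {t : ℝ} (ht : t ∈ Ioc 0 T) :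
    ∀ᵐ x ∂cellMeasure d L, |θ t x| ≤ 2 ^ (d + 1) * Real.exp (-(ν * t / L ^ 2 / d)) * m := by
  have hd' : (0 : ℝ) < d := by exact_mod_cast hd
  set q := Real.exp (-(ν * t / L ^ 2 / d)) with hq
  have ht0 := ht.1
  -- The iteration starts at k = 1, with τ 1 = t/2, because τ 0 = 0 is not a time at which the
  -- solution is controlled.
  let τ (k : ℕ) : ℝ := t * (1 - 1 / 2 ^ k)
  have hτlt (k : ℕ) : τ k < t := by
    have : 0 < t * (1 / 2 ^ k) := by positivity
    simp only [τ]; linarith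
  have hτ0 {k : ℕ} (hk : 1 ≤ k) : 0 < τ k := by
    refine mul_pos ht0 (sub_pos.2 ?_)
    rw [div_lt_one (by positivity)]
    exact one_lt_pow₀ one_lt_two (by omega)
  have hτT {k : ℕ} (hk : 1 ≤ k) : τ k ∈ Ioc 0 T := ⟨hτ0 hk, (hτlt k).le.trans ht.2⟩
  -- For k ≥ 1 this is the moment of order 2^k, written as a square to match the moment lemmas.
  let M (k : ℕ) : ℝ := ∫ x, (θ (τ k) x ^ 2 ^ (k - 1)) ^ 2 ∂cellMeasure d L
  have hM (k : ℕ) : 0 ≤ M k := integral_nonneg fun x => sq_nonneg _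
  have hbase : M 1 ≤ q ^ 2 * (L ^ d * m ^ 2) := by
    have h1 := hθ.integral_sq_le hd hL hν hT hu h0 hm (hτT le_rfl)
    have h2 : Real.exp (-(4 * ν / (d * L ^ 2) * τ 1)) = q ^ 2 := by
      rw [hq, ← Real.exp_nat_mul]
      congr 1
      simp only [τ]
      push_cast
      field_simp
      norm_num
    rw [h2] at h1
    simpa [M] using h1
  have hstep (k : ℕ) (hk : 1 ≤ k) : M (k + 1) ≤
      q ^ (2 ^ (k + 1)) * (m ^ 2 ^ k * M k) + (2 ^ k) ^ d * M k ^ 2 / L ^ d := by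
    have h2k : (1 : ℝ) ≤ 2 ^ k := one_le_pow₀ one_le_two
    have hτle : τ k ≤ τ (k + 1) := by
      simp only [τ]
      have : (1 : ℝ) / 2 ^ (k + 1) ≤ 1 / 2 ^ k :=
        one_div_le_one_div_of_le (by positivity) (pow_le_pow_right₀ one_le_two (by omega))
      gcongr
    have h1 := hθ.moment_step hd hL hν hu (h := L / 2 ^ k) (by positivity)
      (div_le_self hL.le h2k) (p := 2 ^ (k - 1)) Nat.one_le_two_pow (hτ0 hk) hτle
      (hτT (k := k + 1) (by omega)).2
    have e1 : 2 * 2 ^ (k - 1) = 2 ^ k := by rw [← pow_succ', Nat.sub_add_cancel hk]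
    -- The rate is 4ν·4^k/(dL²) and the time step t/2^(k+1), so the exponent is 2^(k+1) νt/(dL²).
    have e2 : Real.exp (-(4 * ν / (d * (L / 2 ^ k) ^ 2) * (τ (k + 1) - τ k))) =
        q ^ (2 ^ (k + 1)) := by
      rw [hq, ← Real.exp_nat_mul]
      congr 1
      simp only [τ]
      push_cast
      field_simp
      ring
    have e3 (y : ℝ) : y / (L / 2 ^ k) ^ d = (2 ^ k) ^ d * y / L ^ d := by
      rw [div_pow]; field_simp
    rw [e1, e2, e3] at h1
    refine h1.trans ?_
    have hq0 : 0 ≤ q ^ (2 ^ (k + 1)) := pow_nonneg (Real.exp_pos _).le _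
    refine add_le_add (mul_le_mul_of_nonneg_left ?_ hq0) le_rfl
    have hc := hθ.continuous (hτT hk)
    rw [← integral_const_mul]
    -- Half of the exponent 2^(k+1) is spent on the maximum principle, leaving m^(2^k) times the
    -- moment of order 2^k.
    refine integral_mono_ae (integrable_cellMeasure (by fun_prop))
      (integrable_cellMeasure (by fun_prop)) ?_
    filter_upwards [hθ.ae_abs_le hL hν hT hu h0 hm (hτT hk)] with x hx
    have e4 : (θ (τ k) x ^ 2 ^ (k - 1)) ^ 2 = |θ (τ k) x| ^ 2 ^ k := by
      rw [← pow_mul, mul_comm, e1, Even.pow_abs (Nat.even_pow.2 ⟨even_two, by omega⟩)]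
    rw [e4, ← sq_abs, abs_pow, sq]
    gcongr
  have hq1 : q ≤ 1 := Real.exp_le_one_iff.2 (by
    have : 0 ≤ ν * t / L ^ 2 / d := by positivity
    linarith)
  refine ae_abs_le_of_forall_integral_pow_le (V := L ^ d) (by positivity)
    (fun k => integrable_cellMeasure ((hθ.continuous ht).pow _)) fun k hk => ?_
  have h1 := moser_recursion d hM (by positivity) hm0 (Real.exp_pos _).le hq1 hbase hstep hk
  -- Moments decrease in time, so the fixed time t inherits the bound at each τ k < t.
  have h2 : ∫ x, θ t x ^ 2 ^ k ∂cellMeasure d L ≤ M k := by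
    have := hθ.antitoneOn_moment hL hν hu (p := 2 ^ (k - 1)) Nat.one_le_two_pow (hτT hk) ht
      (hτlt k).le
    simpa only [M, ← pow_mul, ← pow_succ, Nat.sub_add_cancel hk] using this
  have h3 : (1 : ℝ) ≤ (2 ^ k) ^ d * 2 ^ d * 2 := by
    have a1 : (1 : ℝ) ≤ (2 ^ k) ^ d := one_le_pow₀ (one_le_pow₀ one_le_two)
    have a2 : (1 : ℝ) ≤ 2 ^ d := one_le_pow₀ one_le_two
    nlinarith [one_le_mul_of_one_le_of_one_le a1 a2]
  calc _ ≤ M k := h2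
    _ ≤ M k * ((2 ^ k) ^ d * 2 ^ d * 2) := le_mul_of_one_le_right (hM k) h3
    _ = M k * (2 ^ k) ^ d * 2 ^ d * 2 := by ring
    _ ≤ _ := h1

/-! ### From exponential to algebraic decay -/

/-- Raise x ≤ exp x, taken at x = s/(dN), to the power N. -/
theorem exp_neg_div_le {s N : ℝ} {d : ℕ} (hd : 0 < d) (hs : 0 < s) (hN : 0 < N) :
    Real.exp (-(s / d)) ≤ (d * N) ^ N / s ^ N := by
  have hd' : (0 : ℝ) < d := by exact_mod_cast hd
  rw [le_div_iff₀ (by positivity), Real.exp_neg, inv_mul_le_iff₀ (Real.exp_pos _)]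
  have h1 : s ≤ d * N * Real.exp (s / d / N) := by
    have h := Real.add_one_le_exp (s / d / N)
    calc s = d * N * (s / d / N) := by field_simp
      _ ≤ _ := by gcongr; linarith
  calc s ^ N ≤ (d * N * Real.exp (s / d / N)) ^ N := Real.rpow_le_rpow hs.le h1 hN.le
    _ = Real.exp (s / d) * (d * N) ^ N := by
      rw [Real.mul_rpow (by positivity) (Real.exp_pos _).le, ← Real.exp_mul, mul_comm]
      congr 2
      field_simp

/-- Algebraic decay of every order, with constant depending on the order and dimension only. -/
theorem IsSolution.supNorm_le (hθ : IsSolution L ν T u θ₀ θ) (hd : 0 < d) (hL : 0 < L)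
    (hν : 0 < ν) (hT : 0 < T) (hu : IsIncompressibleDrift L T u) (h0 : IsInitialData L θ₀)
    {N : ℝ} (hN : 0 < N) {t : ℝ} (ht : t ∈ Ioc 0 T) :
    supNorm L (θ t) ≤
      ENNReal.ofReal (2 ^ (d + 1) * (d * N) ^ N * L ^ (2 * N) / (ν * t) ^ N) * supNorm L θ₀ := by
  have hνt : 0 < ν * t := mul_pos hν ht.1
  set m := (supNorm L θ₀).toReal
  have hfin : supNorm L θ₀ ≠ ∞ := h0.memLp.2.ne
  have hm : ∀ᵐ x ∂cellMeasure d L, |θ₀ x| ≤ m := by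
    filter_upwards [ae_le_eLpNormEssSup (f := θ₀) (μ := cellMeasure d L)] with x hx
    rw [← eLpNorm_exponent_top] at hx
    have := ENNReal.toReal_mono hfin hx
    simpa using this
  have h1 := hθ.ae_abs_le_exp hd hL hν hT hu h0 ENNReal.toReal_nonneg hm ht
  have h2 : 2 ^ (d + 1) * Real.exp (-(ν * t / L ^ 2 / d)) ≤
      2 ^ (d + 1) * (d * N) ^ N * L ^ (2 * N) / (ν * t) ^ N := by
    have h3 := exp_neg_div_le hd (s := ν * t / L ^ 2) (by positivity) hN
    have h4 : (ν * t / L ^ 2) ^ N = (ν * t) ^ N / L ^ (2 * N) := by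
      rw [Real.div_rpow hνt.le (by positivity), Real.rpow_mul hL.le, Real.rpow_two]
    rw [h4] at h3
    calc _ ≤ 2 ^ (d + 1) * ((d * N) ^ N / ((ν * t) ^ N / L ^ (2 * N))) := by gcongr
      _ = _ := by field_simp
  have h5 : eLpNorm (θ t) ∞ (cellMeasure d L) ≤ ENNReal.ofReal
      (2 ^ (d + 1) * Real.exp (-(ν * t / L ^ 2 / d)) * m) := by
    rw [eLpNorm_exponent_top]
    exact eLpNormEssSup_le_of_ae_bound h1
  refine h5.trans ?_
  rw [ENNReal.ofReal_mul (by positivity), ENNReal.ofReal_toReal hfin]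
  gcongr

end HeatDecay

theorem lemma4p1 :
    (∀ d : ℕ, 3 ≤ d → ∃ c : ℝ, 0 < c ∧
      ∀ (L ν T : ℝ) (u : ℝ → HeatDecay.E d → HeatDecay.E d)
        (θ₀ : HeatDecay.E d → ℝ) (θ : ℝ → HeatDecay.E d → ℝ),
        0 < L → 0 < ν → 0 < T →
        HeatDecay.IsIncompressibleDrift L T u →
        HeatDecay.IsInitialData L θ₀ →
        HeatDecay.IsSolution L ν T u θ₀ θ →
        ∀ t ∈ Ioc 0 T, HeatDecay.supNorm L (θ t) ≤
          ENNReal.ofReal (c * L ^ d / (ν * t) ^ ((d : ℝ) / 2)) * HeatDecay.supNorm L θ₀) ∧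
    (∀ ε : ℝ, 0 < ε → ∃ c : ℝ, 0 < c ∧
      ∀ (L ν T : ℝ) (u : ℝ → HeatDecay.E 2 → HeatDecay.E 2)
        (θ₀ : HeatDecay.E 2 → ℝ) (θ : ℝ → HeatDecay.E 2 → ℝ),
        0 < L → 0 < ν → 0 < T →
        HeatDecay.IsIncompressibleDrift L T u →
        HeatDecay.IsInitialData L θ₀ →
        HeatDecay.IsSolution L ν T u θ₀ θ →
        ∀ t ∈ Ioc 0 T, HeatDecay.supNorm L (θ t) ≤
          ENNReal.ofReal (c * L ^ (2 + ε) / (ν * t) ^ ((2 + ε) / 2)) *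
            HeatDecay.supNorm L θ₀) := by
  refine ⟨fun d hd => ?_, fun ε hε => ?_⟩
  · have hd' : (0 : ℝ) < d := by exact_mod_cast (by omega : 0 < d)
    -- The constant for order N = d/2, for which L^(2N) = L^d.
    refine ⟨2 ^ (d + 1) * (d * ((d : ℝ) / 2)) ^ ((d : ℝ) / 2), by positivity, ?_⟩
    intro L ν T u θ₀ θ hL hν hT hu h0 hθ t ht
    have h := hθ.supNorm_le (by omega) hL hν hT hu h0 (half_pos hd') ht
    rwa [mul_div_cancel₀ _ two_ne_zero, Real.rpow_natCast] at h
  · have hN : 0 < (2 + ε) / 2 := by positivity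
    refine ⟨2 ^ (2 + 1) * ((2 : ℕ) * ((2 + ε) / 2)) ^ ((2 + ε) / 2), by positivity, ?_⟩
    intro L ν T u θ₀ θ hL hν hT hu h0 hθ t ht
    have h := hθ.supNorm_le two_pos hL hν hT hu h0 hN ht
    rwa [mul_div_cancel₀ (2 + ε) two_ne_zero] at h
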